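/- Let $\mathbb K$ be $\mathbb R$ or $\mathbb C$. For a topological space $T$ and $F\subset T$ put $S_0(F)=F$; let $S_{\alpha+1}(F)$ be the set of all limits in $T$ of sequences in $S_\alpha(F)$; and let $S_\alpha(F)=\bigcup_{\beta<\alpha}S_\beta(F)$ for limit ordinals $\alpha$. The space $T$ is sequential if every sequentially closed subset is closed. It is Fréchet–Urysohn if $S_1(F)=\overline F$ for every $F\subset T$. It has sequential order $\alpha$ if $S_\alpha(F)=\overline F$ for every $F\subset T$ and for every $\beta<\alpha$ there is $F\subset T$ with $S_\beta(F)\ne\overline F$. A Banach space $X$ has weak*-sequential dual ball (respectively, weak*-angelic dual) if the closed unit ball $B_{X^*}$ with the weak* topology is sequential (respectively, Fréchet–Urysohn). Let $\{N_r:r\in\Gamma\}$ be an uncountable maximal almost disjoint family of infinite subsets of $\omega$ (distinct members have finite intersection, and the family is maximal with respect to inclusion among families with this property). The Johnson–Lindenstrauss space $JL_2$ over $\mathbb K$ is the completion of $\operatorname{span}(c_0\cup\{\chi_{N_r}:r\in\Gamma\})\subset\ell_\infty$ with respect to the norm $$\Big\|x+\sum_{1\le i\le k}a_i\chi_{N_{r_i}}\Big\|=\max\Big\{\Big\|x+\sum_{1\le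 i\le k}a_i\chi_{N_{r_i}}\Big\|_\infty,\Big(\sum_{1\le i\le k}|a_i|^2\Big)^{1/2}\Big\},$$ where $x\in c_0$, $a_i\in\mathbb K$, and $r_1,\dots,r_k\in\Gamma$ are distinct. **Theorem.** For every uncountable maximal almost disjoint family of infinite subsets of $\omega$, the space $JL_2$ has weak*-sequential dual ball, the sequential order of $(B_{JL_2^*},w^*)$ is exactly $2$, and $JL_2$ does not have weak*-angelic dual. Consequently, it is not true that every Banach space over $\mathbb K$ with weak*-sequential dual ball has weak*-angelic dual, which answers Plichko's question in the negative. -/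

import Mathlib

open Filter Topology
open scoped ENNReal

/-! ### Iterated sequential closures and the sequential order -/

section SequentialOrder

universe u

/-- The `α`-th sequential closure `S_α(F)`: `S_0(F) = F`, `S_{α+1}(F)` is the set of limits of
sequences in `S_α(F)`, and `S_α(F)` is the union of the `S_β(F)`, `β < α`, if `α` is a limit. -/
noncomputable def iterSeqClosure {T : Type u} [TopologicalSpace T] (F : Set T) (α : Ordinal.{0}) :
    Set T :=
  Ordinal.limitRecOn (motive := fun _ => Set T) α F (fun _ S => seqClosure S)
    (fun a _ S => ⋃ b : Set.Iio a, S b.1 b.2)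

theorem iterSeqClosure_zero {T : Type u} [TopologicalSpace T] (F : Set T) :
    iterSeqClosure F 0 = F := by
  simp [iterSeqClosure]

theorem iterSeqClosure_succ {T : Type u} [TopologicalSpace T] (F : Set T) (α : Ordinal.{0}) :
    iterSeqClosure F (Order.succ α) = seqClosure (iterSeqClosure F α) := by
  simp [iterSeqClosure]

theorem iterSeqClosure_limit {T : Type u} [TopologicalSpace T] (F : Set T) (α : Ordinal.{0})
    (hα : Order.IsSuccLimit α) :
    iterSeqClosure F α = ⋃ β : Set.Iio α, iterSeqClosure F β.1 := by
  simp only [iterSeqClosure]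
  rw [Ordinal.limitRecOn_limit _ _ _ _ hα]

/-- `T` has sequential order (exactly) `α`. -/
def HasSequentialOrder (T : Type u) [TopologicalSpace T] (α : Ordinal.{0}) : Prop :=
  (∀ F : Set T, iterSeqClosure F α = closure F) ∧
    ∀ β < α, ∃ F : Set T, iterSeqClosure F β ≠ closure F

end SequentialOrder

/-! ### The dual ball with the weak* topology -/

section DualBall

/-- The closed unit ball (for the dual norm) of the dual of `X`. As a subset of `WeakDual 𝕜 X` it
carries the weak* topology. -/
def weakStarDualBall (𝕜 X : Type*) [RCLike 𝕜] [NormedAddCommGroup X] [NormedSpace 𝕜 X] :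
    Set (WeakDual 𝕜 X) :=
  {f | ‖WeakDual.toStrongDual f‖ ≤ 1}

/-- `X` has weak*-sequential dual ball. -/
def HasWeakStarSequentialDualBall (𝕜 X : Type*) [RCLike 𝕜] [NormedAddCommGroup X]
    [NormedSpace 𝕜 X] : Prop :=
  SequentialSpace (weakStarDualBall 𝕜 X)

/-- `X` has weak*-angelic dual: the dual ball is weak*-Fréchet–Urysohn. -/
def HasWeakStarAngelicDual (𝕜 X : Type*) [RCLike 𝕜] [NormedAddCommGroup X]
    [NormedSpace 𝕜 X] : Prop :=
  FrechetUrysohnSpace (weakStarDualBall 𝕜 X)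

end DualBall

/-! ### The Johnson–Lindenstrauss space -/

/-- An almost disjoint family of infinite subsets of `ℕ`. The maximal ones are
those with `Maximal IsAlmostDisjointFamily 𝒜` (maximality with respect to inclusion). -/
def IsAlmostDisjointFamily (𝒜 : Set (Set ℕ)) : Prop :=
  (∀ A ∈ 𝒜, A.Infinite) ∧ 𝒜.Pairwise fun A B => (A ∩ B).Finite

namespace JohnsonLindenstrauss

/-- The space `ℓ_∞` of bounded sequences with the supremum norm. -/
abbrev EllInfty (𝕜 : Type*) [RCLike 𝕜] : Type _ := lp (fun _ : ℕ => 𝕜) ∞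

/-- The subspace `c_0` of `ℓ_∞`. -/
def cZero (𝕜 : Type*) [RCLike 𝕜] : Submodule 𝕜 (EllInfty 𝕜) where
  carrier := {x | Tendsto (fun n => x n) atTop (𝓝 0)}
  add_mem' {x y} hx hy := by
    have hxy := Tendsto.add (Set.mem_ofPred_eq ▸ hx) (Set.mem_ofPred_eq ▸ hy)
    simpa using hxy
  zero_mem' := by simp
  smul_mem' c x hx := by
    have hcx := Tendsto.const_mul c (Set.mem_ofPred_eq ▸ hx)
    simpa using hcx

/-- The characteristic function of `A`, as an element of `ℓ_∞`. -/
noncomputable def charFun (𝕜 : Type*) [RCLike 𝕜] (A : Set ℕ) : EllInfty 𝕜 :=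
  ⟨A.indicator fun _ => (1 : 𝕜), memℓp_infty ⟨1, by
    rintro _ ⟨n, rfl⟩
    by_cases hn : n ∈ A <;> simp [hn]⟩⟩

theorem charFun_apply (𝕜 : Type*) [RCLike 𝕜] (A : Set ℕ) (n : ℕ) :
    charFun 𝕜 A n = A.indicator (fun _ => (1 : 𝕜)) n := rfl

/-- The characteristic functions of an almost disjoint family are linearly independent
modulo `c_0`; so the coefficients in `x + ∑ a_i χ_{N_i}`, `x ∈ c_0`, are unique. -/
theorem linearIndependent_mkQ_charFun (𝕜 : Type*) [RCLike 𝕜] {𝒜 : Set (Set ℕ)}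
    (h : IsAlmostDisjointFamily 𝒜) :
    LinearIndependent 𝕜 fun A : 𝒜 => (cZero 𝕜).mkQ (charFun 𝕜 A) := by
  classical
  rw [linearIndependent_iff']
  intro s g hg A hA
  have hmem : ∑ B ∈ s, g B • charFun 𝕜 (B : Set ℕ) ∈ cZero 𝕜 := by
    rw [← Submodule.Quotient.mk_eq_zero, ← Submodule.mkQ_apply, map_sum]
    simpa using hg
  have hlim : Tendsto (fun n => (∑ B ∈ s, g B • charFun 𝕜 (B : Set ℕ) : EllInfty 𝕜) n) atTop
      (𝓝 0) := hmem
  have hfin : (⋃ B ∈ s.erase A, (A : Set ℕ) ∩ (B : Set ℕ)).Finite := by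
    refine Set.Finite.biUnion (s.erase A).finite_toSet fun B hB => ?_
    have hne : B ≠ A := Finset.ne_of_mem_erase hB
    exact h.2 A.2 B.2 fun hAB => hne (Subtype.ext hAB.symm)
  have hinf : ((A : Set ℕ) \ ⋃ B ∈ s.erase A, (A : Set ℕ) ∩ (B : Set ℕ)).Infinite :=
    (h.1 A A.2).sdiff hfin
  have hfreq : ∃ᶠ n in atTop,
      (∑ B ∈ s, g B • charFun 𝕜 (B : Set ℕ) : EllInfty 𝕜) n = g A := by
    refine (Nat.frequently_atTop_iff_infinite.2 hinf).mono fun n hn => ?_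
    rw [lp.coeFn_sum, Finset.sum_apply, Finset.sum_eq_single_of_mem A hA]
    · simp [charFun_apply, hn.1]
    · intro B hB hBA
      have hnB : n ∉ (B : Set ℕ) := fun hnB => hn.2 <| by
        simp only [Set.mem_iUnion]
        exact ⟨B, Finset.mem_erase.2 ⟨hBA, hB⟩, hn.1, hnB⟩
      simp [charFun_apply, hnB]
  by_contra hne
  have hev := hlim.eventually (isOpen_ne.mem_nhds (Ne.symm hne))
  obtain ⟨n, hn1, hn2⟩ := (hfreq.and_eventually hev).exists
  exact hn2 hn1

/-- The linear span of `c_0` and the characteristic functions `χ_A`, `A ∈ 𝒜`, in `ℓ_∞`. -/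
noncomputable def spanSubmodule (𝕜 : Type*) [RCLike 𝕜] (𝒜 : Set (Set ℕ)) : Submodule 𝕜 (EllInfty 𝕜) :=
  Submodule.span 𝕜 ((cZero 𝕜 : Set (EllInfty 𝕜)) ∪ charFun 𝕜 '' 𝒜)

theorem mkQ_mem_span (𝕜 : Type*) [RCLike 𝕜] {𝒜 : Set (Set ℕ)} {y : EllInfty 𝕜}
    (hy : y ∈ spanSubmodule 𝕜 𝒜) :
    (cZero 𝕜).mkQ y ∈
      Submodule.span 𝕜 (Set.range fun A : 𝒜 => (cZero 𝕜).mkQ (charFun 𝕜 A)) := by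
  refine (Submodule.span_le (p := (Submodule.span 𝕜
    (Set.range fun A : 𝒜 => (cZero 𝕜).mkQ (charFun 𝕜 A))).comap (cZero 𝕜).mkQ)).2 ?_ hy
  rintro z (hz | ⟨A, hA, rfl⟩)
  · have h0 : (cZero 𝕜).mkQ z = 0 := (Submodule.Quotient.mk_eq_zero _).2 hz
    simp only [SetLike.mem_coe, Submodule.mem_comap, h0]
    exact Submodule.zero_mem _
  · exact Submodule.subset_span ⟨⟨A, hA⟩, rfl⟩

/-- The linear span of `c_0` and the characteristic functions `χ_A`, `A ∈ 𝒜`, as a type of its own,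
because it gets a norm other than the supremum norm. -/
def JLSpan (𝕜 : Type*) [RCLike 𝕜] {𝒜 : Set (Set ℕ)} (_h : IsAlmostDisjointFamily 𝒜) : Type _ :=
  spanSubmodule 𝕜 𝒜

section

variable (𝕜 : Type*) [RCLike 𝕜] {𝒜 : Set (Set ℕ)} (h : IsAlmostDisjointFamily 𝒜)

noncomputable instance : AddCommGroup (JLSpan 𝕜 h) :=
  inferInstanceAs (AddCommGroup (spanSubmodule 𝕜 𝒜))

noncomputable instance : Module 𝕜 (JLSpan 𝕜 h) :=
  inferInstanceAs (Module 𝕜 (spanSubmodule 𝕜 𝒜))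

/-- The inclusion of the span into `ℓ_∞`. -/
noncomputable def toEllInfty : JLSpan 𝕜 h →ₗ[𝕜] EllInfty 𝕜 := (spanSubmodule 𝕜 𝒜).subtype

/-- The coefficients `(a_A)` of the element `x + ∑ a_A χ_A`, where `x ∈ c_0`. -/
noncomputable def coeff : JLSpan 𝕜 h →ₗ[𝕜] (𝒜 →₀ 𝕜) :=
  (linearIndependent_mkQ_charFun 𝕜 h).repr ∘ₗ
    ((cZero 𝕜).mkQ ∘ₗ toEllInfty 𝕜 h).codRestrict _ fun y => mkQ_mem_span 𝕜 y.2

/-- A finitely supported family as an element of `ℓ_2(Γ)`. -/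
noncomputable def toEllTwo (Γ : Type*) : (Γ →₀ 𝕜) →ₗ[𝕜] lp (fun _ : Γ => 𝕜) 2 where
  toFun a := ⟨fun i => a i, (memℓp_gen_iff (by norm_num)).2 <|
    summable_of_ne_finset_zero (s := a.support) fun i hi => by
      have h0 : a i = 0 := by simpa using hi
      simp [h0]⟩
  map_add' _ _ := rfl
  map_smul' _ _ := rfl

theorem toEllTwo_apply {Γ : Type*} (a : Γ →₀ 𝕜) (i : Γ) : toEllTwo 𝕜 Γ a i = a i := rfl

/-- The map `y ↦ (y, (a_A))`, from which the norm is induced; the norm of a product is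
the maximum of the two norms. -/
noncomputable def toProd :
    JLSpan 𝕜 h →ₗ[𝕜] EllInfty 𝕜 × lp (fun _ : 𝒜 => 𝕜) 2 :=
  (toEllInfty 𝕜 h).prod (toEllTwo 𝕜 𝒜 ∘ₗ coeff 𝕜 h)

theorem toProd_injective : Function.Injective (toProd 𝕜 h) := fun _ _ hxy =>
  Subtype.ext (congrArg Prod.fst hxy)

noncomputable instance : NormedAddCommGroup (JLSpan 𝕜 h) :=
  NormedAddCommGroup.induced _ _ (toProd 𝕜 h) (toProd_injective 𝕜 h)

noncomputable instance : NormedSpace 𝕜 (JLSpan 𝕜 h) :=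
  NormedSpace.induced 𝕜 _ _ (toProd 𝕜 h)

/-- The element `x + ∑ a_A χ_A` of the span. -/
noncomputable def mkSpan (x : cZero 𝕜) (a : 𝒜 →₀ 𝕜) : JLSpan 𝕜 h :=
  ⟨x + a.sum fun A c => c • charFun 𝕜 (A : Set ℕ),
    Submodule.add_mem _ (Submodule.subset_span (Or.inl x.2)) <|
      Submodule.sum_mem _ fun A _ => Submodule.smul_mem _ _ <|
        Submodule.subset_span (Or.inr ⟨A, A.2, rfl⟩)⟩

theorem coeff_mkSpan (x : cZero 𝕜) (a : 𝒜 →₀ 𝕜) : coeff 𝕜 h (mkSpan 𝕜 h x a) = a := by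
  refine (linearIndependent_mkQ_charFun 𝕜 h).repr_eq ?_
  have h0 : (cZero 𝕜).mkQ (x : EllInfty 𝕜) = 0 := (Submodule.Quotient.mk_eq_zero _).2 x.2
  change _ = (cZero 𝕜).mkQ (x + a.sum fun A c => c • charFun 𝕜 (A : Set ℕ))
  rw [map_add, h0, zero_add, Finsupp.linearCombination_apply, map_finsuppSum]
  simp

/-- The norm of the span:
`‖x + ∑ a_A χ_A‖ = max (‖x + ∑ a_A χ_A‖_∞, (∑ |a_A|²)^{1/2})` for `x ∈ c_0`. -/
theorem norm_mkSpan (x : cZero 𝕜) (a : 𝒜 →₀ 𝕜) :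
    ‖mkSpan 𝕜 h x a‖ =
      max ‖(x : EllInfty 𝕜) + a.sum fun A c => c • charFun 𝕜 (A : Set ℕ)‖
        (Real.sqrt (∑ A ∈ a.support, ‖a A‖ ^ 2)) := by
  change max ‖_‖ ‖toEllTwo 𝕜 𝒜 (coeff 𝕜 h (mkSpan 𝕜 h x a))‖ = _
  rw [coeff_mkSpan]
  congr 1
  rw [lp.norm_eq_tsum_rpow (by norm_num), Real.sqrt_eq_rpow, tsum_eq_sum (s := a.support)]
  · simp [toEllTwo_apply]
  · intro A hA
    have h0 : a A = 0 := by simpa using hA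
    simp [toEllTwo_apply, h0]

/-- Every element of the span has the form `x + ∑ a_A χ_A`. -/
theorem mkSpan_surjective (y : JLSpan 𝕜 h) : ∃ x a, mkSpan 𝕜 h x a = y := by
  have hy : y.1 ∈ Submodule.span 𝕜 ((cZero 𝕜 : Set (EllInfty 𝕜)) ∪ charFun 𝕜 '' 𝒜) := y.2
  rw [Submodule.span_union, Submodule.span_eq, Set.image_eq_range,
    Submodule.mem_sup] at hy
  obtain ⟨x, hx, z, hz, hxz⟩ := hy
  obtain ⟨a, ha⟩ := (Finsupp.mem_span_range_iff_exists_finsupp).1 hz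
  exact ⟨⟨x, hx⟩, a, Subtype.ext (by rw [← hxz, ← ha]; rfl)⟩

/-- The Johnson–Lindenstrauss space `JL₂` of an almost disjoint family: the completion of the span
of `c_0` and the characteristic functions. -/
abbrev JLTwo : Type _ := UniformSpace.Completion (JLSpan 𝕜 h)

end

end JohnsonLindenstrauss

/-!
Write `e_n` for the unit vectors of `c₀ ⊆ JL₂` and `χ_A` for the characteristic functions of the
members of the family. A functional on `JL₂` is determined by its values on the `e_n` and the `χ_A`,
so by compactness of the dual ball, weak* convergence in the ball is convergence at these vectors.
Since finitely many `A` become disjoint after removing an initial segment of `ℕ`, the functionals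
that vanish on `c₀` satisfy `∑ |h(χ_A)|² ≤ ‖h‖²` (`sum_norm_apply_charVec_sq_le`).

*Two sequential closures suffice* (`closure_subset_seqClosure_seqClosure`). Let `f` be in the weak*
closure of `F` and let `W` be a closed neighbourhood of `f`. As there are only countably many `e_n`,
there is a countably generated filter on `F ∩ W` along which the values at each `e_n` tend to those
of `f`. For every finer filter, the limits at the `χ_A`, minus the values of `f`, have square sum at
most `4`. A filter for which this square sum cannot be increased by refining converges at every
`χ_A` (`exists_countablyGenerated_le_forall_tendsto`), and some sequence tends to
any countably generated filter. So `W` contains a limit `g` of a sequence in `F` that agrees with `f` on `c₀`.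
Such `g` form a bounded subset of `f + ℓ₂(𝒜)` with the pointwise topology, where the
Fréchet–Urysohn property holds (`exists_seq_forall_tendsto_zero`), so that `f` is the limit of a
sequence of them.

*One sequential closure does not suffice.* The zero functional is a weak* cluster point of the
coordinate functionals (`zeroBall_mem_closure`), because finitely many members of an infinite almost
disjoint family never cover a cofinite set. It is not the limit of a sequence of them: by maximality,
every infinite set of indices meets some `A` in an infinite set, and there the value at `χ_A` is `1`
(`zeroBall_notMem_seqClosure`).
-/

/-! ### Countably generated filters along which a family of functions converges -/

/-- Exhaustion: a bounded antitone real function on a preorder in which decreasing sequences have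
lower bounds is constant below some point. -/
theorem exists_forall_le_of_antitone {P : Type*} [Preorder P] (p₀ : P) {w : P → ℝ}
    (hw : Antitone w) {C : ℝ} (hC : ∀ p, w p ≤ C)
    (hinf : ∀ u : ℕ → P, Antitone u → ∃ p, ∀ n, p ≤ u n) :
    ∃ p, ∀ q ≤ p, w q ≤ w p := by
  have step : ∀ (n : ℕ) (p : P), ∃ p' ≤ p, ∀ q ≤ p, w q ≤ w p' + 1 / ((n : ℝ) + 1) := by
    intro n p
    have hbdd : BddAbove (w '' Set.Iic p) := ⟨C, by rintro _ ⟨q, -, rfl⟩; exact hC q⟩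
    have hne : (w '' Set.Iic p).Nonempty := ⟨w p, p, le_rfl, rfl⟩
    obtain ⟨_, ⟨p', hp', rfl⟩, hlt⟩ := exists_lt_of_lt_csSup hne
      (sub_lt_self (sSup (w '' Set.Iic p)) (Nat.one_div_pos_of_nat (α := ℝ) (n := n)))
    refine ⟨p', hp', fun q hq => ?_⟩
    have := le_csSup hbdd ⟨q, hq, rfl⟩
    linarith
  choose g hg hgw using step
  let u : ℕ → P := fun n => Nat.rec p₀ (fun k p => g k p) n
  obtain ⟨p, hp⟩ := hinf u (antitone_nat_of_succ_le fun n => hg n (u n))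
  refine ⟨p, fun q hq => le_of_forall_pos_le_add fun ε hε => ?_⟩
  obtain ⟨n, hn⟩ := exists_nat_one_div_lt hε
  have h1 := hgw n (u n) q (hq.trans (hp n))
  have h2 : w (g n (u n)) ≤ w p := hw (hp (n + 1))
  linarith

/-- Let `φ r`, `r ∈ Γ`, be bounded functions such that the limits of finitely many of them along a
filter finer than `L₀` always have square sum at most `C`. Then all the `φ r` converge along some
countably generated filter finer than `L₀`. The filter is one for which the square sum of all
existing limits is as large as it can become by refining: a `φ r` without limit would acquire a
nonzero limit along a finer filter and enlarge the sum. -/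
theorem exists_countablyGenerated_le_forall_tendsto {𝕜 T Γ : Type*} [RCLike 𝕜] (φ : Γ → T → 𝕜)
    (hφ : ∀ r, ∃ M, ∀ t, ‖φ r t‖ ≤ M) (L₀ : Filter T) [L₀.NeBot] [L₀.IsCountablyGenerated] (C : ℝ)
    (hC : ∀ L : Filter T, L.NeBot → L ≤ L₀ → ∀ (S : Finset Γ) (a : Γ → 𝕜),
      (∀ r ∈ S, Tendsto (φ r) L (𝓝 (a r))) → ∑ r ∈ S, ‖a r‖ ^ 2 ≤ C) :
    ∃ L ≤ L₀, L.NeBot ∧ L.IsCountablyGenerated ∧ ∀ r, ∃ a, Tendsto (φ r) L (𝓝 a) := by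
  classical
  let P := {L : Filter T // L.NeBot ∧ L.IsCountablyGenerated ∧ L ≤ L₀}
  let sums : P → Set ℝ := fun L => {s | ∃ (S : Finset Γ) (a : Γ → 𝕜),
    (∀ r ∈ S, Tendsto (φ r) L.1 (𝓝 (a r))) ∧ ∑ r ∈ S, ‖a r‖ ^ 2 = s}
  have hle : ∀ L : P, ∀ s ∈ sums L, s ≤ C := by
    rintro L _ ⟨S, a, ha, rfl⟩
    exact hC L.1 L.2.1 L.2.2.2 S a ha
  have hbdd : ∀ L : P, BddAbove (sums L) := fun L => ⟨C, hle L⟩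
  have hne : ∀ L : P, (sums L).Nonempty := fun L => ⟨0, ∅, 0, by simp, by simp⟩
  obtain ⟨L, hL⟩ := exists_forall_le_of_antitone (P := P) (w := fun L => sSup (sums L))
    ⟨L₀, ‹_›, ‹_›, le_rfl⟩
    (fun L L' hLL' => csSup_le_csSup (hbdd L) (hne L') (by
      rintro _ ⟨S, a, ha, rfl⟩
      exact ⟨S, a, fun r hr => (ha r hr).mono_left hLL', rfl⟩))
    (C := C) (fun L => csSup_le (hne L) (hle L)) (by
      intro u hu
      have hdir : Directed (· ≥ ·) fun n => (u n).1 :=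
        directed_of_isDirected_le fun m n hmn => hu hmn
      have : ∀ n, (u n).1.IsCountablyGenerated := fun n => (u n).2.2.1
      exact ⟨⟨⨅ n, (u n).1, iInf_neBot_of_directed' hdir fun n => (u n).2.1, inferInstance,
        (iInf_le _ 0).trans (u 0).2.2.2⟩, fun n => iInf_le (fun n => (u n).1) n⟩)
  obtain ⟨L, hLne, hLcg, hLle⟩ := L
  refine ⟨L, hLle, hLne, hLcg, fun r => ?_⟩
  by_contra hr
  push Not at hr
  -- As `φ r` does not tend to `0`, it tends to some nonzero `a` along a finer filter `L'`.
  obtain ⟨ε, hε, hfreq⟩ : ∃ ε > 0, ∃ᶠ t in L, ε ≤ ‖φ r t‖ := by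
    have := hr 0
    rw [Metric.tendsto_nhds] at this
    push Not at this
    simpa [dist_zero_right] using this
  obtain ⟨M, hM⟩ := hφ r
  have hL1 : (L ⊓ 𝓟 {t | ε ≤ ‖φ r t‖}).NeBot := frequently_mem_iff_neBot.1 hfreq
  have hK : IsCompact (Metric.closedBall (0 : 𝕜) M ∩ {z | ε ≤ ‖z‖}) :=
    (isCompact_closedBall _ _).inter_right (isClosed_le continuous_const continuous_norm)
  obtain ⟨a, ⟨-, haε⟩, ha⟩ := hK.exists_mapClusterPt (f := L ⊓ 𝓟 {t | ε ≤ ‖φ r t‖}) (u := φ r)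
    (le_principal_iff.2 (mem_map.2 (mem_of_superset (mem_inf_of_right (mem_principal_self _))
      fun t ht => ⟨by simpa using hM t, ht⟩)))
  let L' := comap (φ r) (𝓝 a) ⊓ (L ⊓ 𝓟 {t | ε ≤ ‖φ r t‖})
  have hL'ne : L'.NeBot := by
    rw [← map_neBot_iff (φ r), Filter.push_pull']
    exact ha
  have hL'L : L' ≤ L := inf_le_right.trans inf_le_left
  have hL'a : Tendsto (φ r) L' (𝓝 a) := tendsto_comap.mono_left inf_le_left
  let L'' : P := ⟨L', hL'ne, inferInstance, hL'L.trans hLle⟩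
  have hstab : sSup (sums L'') ≤ sSup (sums ⟨L, hLne, hLcg, hLle⟩) := hL L'' hL'L
  have hgain : sSup (sums ⟨L, hLne, hLcg, hLle⟩) ≤ sSup (sums L'') - ε ^ 2 := by
    refine csSup_le (hne _) ?_
    rintro _ ⟨S, b, hb, rfl⟩
    have hrS : r ∉ S := fun hrS => hr _ (hb r hrS)
    have hmem : ‖a‖ ^ 2 + ∑ s ∈ S, ‖b s‖ ^ 2 ∈ sums L'' := by
      refine ⟨insert r S, Function.update b r a, ?_, ?_⟩
      · intro s hs
        rcases Finset.mem_insert.1 hs with rfl | hs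
        · simpa using hL'a
        · have hsr : s ≠ r := fun h => hrS (h ▸ hs)
          simpa [hsr] using (hb s hs).mono_left hL'L
      · rw [Finset.sum_insert hrS, Function.update_self]
        refine congrArg _ (Finset.sum_congr rfl fun s hs => ?_)
        rw [Function.update_of_ne (ne_of_mem_of_not_mem hs hrS)]
    have h1 := le_csSup (hbdd L'') hmem
    have h2 : ε ^ 2 ≤ ‖a‖ ^ 2 := pow_le_pow_left₀ hε.le haε 2
    linarith
  have := pow_pos hε 2
  linarith

/-! ### Weakly null sequences in balls of `ℓ₂(Γ)` -/

/-- Fréchet–Urysohn property at `0` of bounded subsets of `ℓ₂(Γ)` with the pointwise topology: if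
`0` is in the pointwise closure of `D`, a sequence in `D` tends to `0` pointwise. The sequence is
chosen so that each term is small where one of the earlier terms is not. -/
theorem exists_seq_forall_tendsto_zero {𝕜 Γ D : Type*} [RCLike 𝕜] (φ : D → Γ → 𝕜) (C : ℝ)
    (hC : ∀ (d : D) (S : Finset Γ), ∑ r ∈ S, ‖φ d r‖ ^ 2 ≤ C)
    (hD : ∀ (S : Finset Γ) (ε : ℝ), 0 < ε → ∃ d, ∀ r ∈ S, ‖φ d r‖ < ε) :
    ∃ d : ℕ → D, ∀ r, Tendsto (fun n => φ (d n) r) atTop (𝓝 0) := by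
  classical
  have hfin : ∀ (d : D) (ε : ℝ), 0 < ε → {r | ε ≤ ‖φ d r‖}.Finite := by
    intro d ε hε
    by_contra hinf
    obtain ⟨N, hN⟩ := exists_nat_gt (C / ε ^ 2)
    obtain ⟨S, hS, hcard⟩ := Set.Infinite.exists_subset_card_eq hinf N
    have h1 : (S.card : ℝ) * ε ^ 2 ≤ ∑ r ∈ S, ‖φ d r‖ ^ 2 := by
      rw [← nsmul_eq_mul]
      exact Finset.card_nsmul_le_sum _ _ _ fun r hr => pow_le_pow_left₀ hε.le (hS hr) 2
    rw [div_lt_iff₀ (pow_pos hε 2), ← hcard] at hN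
    exact absurd (h1.trans (hC d S)) (not_le.2 hN)
  have hpos : ∀ n : ℕ, (0 : ℝ) < 1 / ((n : ℝ) + 1) := fun n => Nat.one_div_pos_of_nat
  obtain ⟨f, -, hf⟩ := exists_seq_of_forall_finset_exists (fun _ : ℕ × D => True)
    (fun x y => x.1 < y.1 ∧ ∀ r, 1 / ((y.1 : ℝ) + 1) ≤ ‖φ x.2 r‖ →
      ‖φ y.2 r‖ < 1 / ((y.1 : ℝ) + 1)) (by
    intro s _
    let n := s.sup Prod.fst + 1
    obtain ⟨d, hd⟩ := hD (s.biUnion fun x => (hfin x.2 _ (hpos n)).toFinset) _ (hpos n)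
    refine ⟨(n, d), trivial, fun x hx => ⟨Nat.lt_succ_of_le (Finset.le_sup hx), fun r hr => ?_⟩⟩
    exact hd r (Finset.mem_biUnion.2 ⟨x, hx, by simpa using hr⟩))
  have hmono : StrictMono fun n => (f n).1 := fun m n hmn => (hf m n hmn).1
  have hlim : Tendsto (fun n => 1 / (((f n).1 : ℝ) + 1)) atTop (𝓝 0) :=
    tendsto_one_div_add_atTop_nhds_zero_nat.comp hmono.tendsto_atTop
  refine ⟨fun n => (f n).2, fun r => ?_⟩
  by_cases hr : ∃ m, φ (f m).2 r ≠ 0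
  · obtain ⟨m, hm⟩ := hr
    refine squeeze_zero_norm' ?_ hlim
    filter_upwards [eventually_gt_atTop m, hlim.eventually (gt_mem_nhds (norm_pos_iff.2 hm))]
      with n hmn hn
    exact ((hf m n hmn).2 r hn.le).le
  · push Not at hr
    simp [hr]

/-! ### Dual balls of sequential order at most two -/

section DualBall

variable {𝕜 X : Type*} [RCLike 𝕜] [NormedAddCommGroup X] [NormedSpace 𝕜 X]

instance compactSpace_weakStarDualBall : CompactSpace (weakStarDualBall 𝕜 X) := by
  rw [← isCompact_iff_compactSpace]
  convert WeakDual.isCompact_closedBall (𝕜 := 𝕜) (E := X) 0 1 using 1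
  ext f
  simp [weakStarDualBall]

theorem continuous_weakStarDualBall_eval (x : X) :
    Continuous fun f : weakStarDualBall 𝕜 X => f.1 x :=
  (WeakDual.eval_continuous x).comp continuous_subtype_val

theorem norm_weakStarDualBall_apply_le (f : weakStarDualBall 𝕜 X) (x : X) : ‖f.1 x‖ ≤ ‖x‖ := by
  simpa using (WeakDual.toStrongDual f.1).le_of_opNorm_le f.2 x

/-- The difference of two elements of the dual ball, as an element of the dual space. -/
noncomputable def ballSub (g f : weakStarDualBall 𝕜 X) : StrongDual 𝕜 X :=
  WeakDual.toStrongDual g.1 - WeakDual.toStrongDual f.1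

theorem ballSub_apply (g f : weakStarDualBall 𝕜 X) (x : X) : ballSub g f x = g.1 x - f.1 x := rfl

theorem norm_ballSub_le (g f : weakStarDualBall 𝕜 X) : ‖ballSub g f‖ ≤ 2 := by
  have h1 : ‖WeakDual.toStrongDual g.1‖ ≤ 1 := g.2
  have h2 : ‖WeakDual.toStrongDual f.1‖ ≤ 1 := f.2
  exact (norm_sub_le _ _).trans (by linarith)

theorem tendsto_weakStarDualBall_of_separating {Z : Set X}
    (hZ : ∀ h : StrongDual 𝕜 X, (∀ z ∈ Z, h z = 0) → h = 0) {L : Filter (weakStarDualBall 𝕜 X)}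
    {f : weakStarDualBall 𝕜 X} (hL : ∀ z ∈ Z, Tendsto (fun g => g.1 z) L (𝓝 (f.1 z))) :
    L ≤ 𝓝 f := by
  refine le_nhds_of_unique_clusterPt fun g hg => ?_
  have hg' : (𝓝 g ⊓ L).NeBot := hg
  have hzero : ballSub g f = 0 := hZ _ fun z hz => by
    rw [ballSub_apply, sub_eq_zero]
    exact tendsto_nhds_unique
      (((continuous_weakStarDualBall_eval z).tendsto g).mono_left (inf_le_left (b := L)))
      ((hL z hz).mono_left inf_le_right)
  refine Subtype.ext (ContinuousLinearMap.ext fun x => ?_)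
  have := DFunLike.congr_fun hzero x
  rwa [ballSub_apply, _root_.zero_apply, sub_eq_zero] at this

/-- Suppose that the vectors `e n` and `χ r` separate the functionals, and that on the annihilator
of `(e n)` the map `h ↦ (h (χ r))` is a contraction into `ℓ₂(Γ)`. Then two sequential closures
suffice in the dual ball: if `f ∈ closure F`, then `f` is in the closure of the set of those limits
`g` of sequences of `F` that agree with `f` on all the `e n`, and these `g` form a bounded subset
of `f + ℓ₂(Γ)`. -/
theorem closure_subset_seqClosure_seqClosure {Γ : Type*} (e : ℕ → X) (χ : Γ → X)
    (hsep : ∀ h : StrongDual 𝕜 X, (∀ n, h (e n) = 0) → (∀ r, h (χ r) = 0) → h = 0)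
    (hbessel : ∀ h : StrongDual 𝕜 X, (∀ n, h (e n) = 0) →
      ∀ S : Finset Γ, ∑ r ∈ S, ‖h (χ r)‖ ^ 2 ≤ ‖h‖ ^ 2)
    (F : Set (weakStarDualBall 𝕜 X)) : closure F ⊆ seqClosure (seqClosure F) := by
  intro f hf
  have hbessel' : ∀ g : weakStarDualBall 𝕜 X, (∀ n, g.1 (e n) = f.1 (e n)) → ∀ S : Finset Γ,
      ∑ r ∈ S, ‖ballSub g f (χ r)‖ ^ 2 ≤ 2 ^ 2 := fun g hg S =>
    (hbessel _ (fun n => by rw [ballSub_apply, hg, sub_self]) S).trans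
      (pow_le_pow_left₀ (norm_nonneg _) (norm_ballSub_le g f) 2)
  have hsep' : ∀ h : StrongDual 𝕜 X, (∀ z ∈ Set.range e ∪ Set.range χ, h z = 0) → h = 0 :=
    fun h hh => hsep h (fun n => hh _ (Or.inl ⟨n, rfl⟩)) (fun r => hh _ (Or.inr ⟨r, rfl⟩))
  let D := {g : weakStarDualBall 𝕜 X // g ∈ seqClosure F ∧ ∀ n, g.1 (e n) = f.1 (e n)}
  -- Every closed neighbourhood `W` of `f` meets `D`.
  have hD : ∀ W : Set (weakStarDualBall 𝕜 X), IsClosed W → W ∈ 𝓝 f → ∃ g : D, g.1 ∈ W := by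
    intro W hWc hW
    let L₀ : Filter (weakStarDualBall 𝕜 X) :=
      𝓟 (F ∩ W) ⊓ ⨅ n, comap (fun g => g.1 (e n)) (𝓝 (f.1 (e n)))
    have hne : L₀.NeBot := by
      have h1 : (𝓝 f ⊓ 𝓟 F).NeBot := mem_closure_iff_clusterPt.1 hf
      refine h1.mono (le_inf (le_principal_iff.2 ?_) (le_iInf fun n => ?_))
      · exact inter_mem (mem_inf_of_right (mem_principal_self F)) (mem_inf_of_left hW)
      · exact inf_le_left.trans
          (tendsto_iff_comap.1 ((continuous_weakStarDualBall_eval (e n)).tendsto f))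
    have hL₀e : ∀ n, Tendsto (fun g => g.1 (e n)) L₀ (𝓝 (f.1 (e n))) := fun n =>
      tendsto_iff_comap.2 (inf_le_right.trans (iInf_le _ n))
    have hcluster : ∀ L : Filter (weakStarDualBall 𝕜 X), L.NeBot → L ≤ L₀ →
        ∃ g : weakStarDualBall 𝕜 X, (∀ n, g.1 (e n) = f.1 (e n)) ∧
          ∀ x a, Tendsto (fun g' => g'.1 x) L (𝓝 a) → g.1 x = a := by
      intro L hL hLL
      obtain ⟨g, hg⟩ := exists_clusterPt_of_compactSpace L
      have hg' : (𝓝 g ⊓ L).NeBot := hg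
      have key : ∀ x a, Tendsto (fun g' => g'.1 x) L (𝓝 a) → g.1 x = a := fun x a ha =>
        tendsto_nhds_unique
          (((continuous_weakStarDualBall_eval x).tendsto g).mono_left (inf_le_left (b := L)))
          (ha.mono_left inf_le_right)
      exact ⟨g, fun n => key _ _ ((hL₀e n).mono_left hLL), key⟩
    obtain ⟨L, hLL, hLne, hLcg, hL⟩ := exists_countablyGenerated_le_forall_tendsto
      (fun r (g : weakStarDualBall 𝕜 X) => ballSub g f (χ r))
      (fun r => ⟨2 * ‖χ r‖, fun g => (ballSub g f).le_of_opNorm_le (norm_ballSub_le g f) _⟩)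
      L₀ (2 ^ 2) (by
        intro L hLne hLL S a ha
        obtain ⟨g, hge, hg⟩ := hcluster L hLne hLL
        refine le_trans (le_of_eq (Finset.sum_congr rfl fun r hr => ?_)) (hbessel' g hge S)
        rw [ballSub_apply, hg (χ r) (a r + f.1 (χ r)) ?_, add_sub_cancel_right]
        simpa [ballSub_apply] using (ha r hr).add_const (f.1 (χ r)))
    obtain ⟨g, hge, hg⟩ := hcluster L hLne hLL
    have hLg : L ≤ 𝓝 g := by
      refine tendsto_weakStarDualBall_of_separating hsep' ?_
      rintro _ (⟨n, rfl⟩ | ⟨r, rfl⟩)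
      · rw [hge]
        exact (hL₀e n).mono_left hLL
      · obtain ⟨a, ha⟩ := hL r
        have ha' : Tendsto (fun g' : weakStarDualBall 𝕜 X => g'.1 (χ r)) L
            (𝓝 (a + f.1 (χ r))) := by
          simpa [ballSub_apply] using ha.add_const (f.1 (χ r))
        rwa [hg _ _ ha']
    have hLFW : F ∩ W ∈ L := le_principal_iff.1 (hLL.trans inf_le_left)
    obtain ⟨u, hu⟩ := exists_seq_tendsto L
    obtain ⟨N, hN⟩ := eventually_atTop.1 (hu.eventually hLFW)
    have hu' : Tendsto (fun n => u (n + N)) atTop (𝓝 g) :=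
      (hu.mono_right hLg).comp (tendsto_add_atTop_nat N)
    exact ⟨⟨g, ⟨fun n => u (n + N), fun n => (hN _ (Nat.le_add_left _ _)).1, hu'⟩, hge⟩,
      hWc.mem_of_tendsto hu' (Eventually.of_forall fun n => (hN _ (Nat.le_add_left _ _)).2)⟩
  obtain ⟨d, hd⟩ := exists_seq_forall_tendsto_zero (fun (g : D) r => ballSub g.1 f (χ r)) (2 ^ 2)
    (fun g => hbessel' g.1 g.2.2) (by
      intro S ε hε
      have hcont : ∀ r, Continuous fun g : weakStarDualBall 𝕜 X => ‖ballSub g f (χ r)‖ :=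
        fun r => ((continuous_weakStarDualBall_eval (χ r)).sub continuous_const).norm
      obtain ⟨g, hg⟩ := hD (⋂ r ∈ S, {g | ‖ballSub g f (χ r)‖ ≤ ε / 2})
        (isClosed_biInter fun r _ => isClosed_le (hcont r) continuous_const)
        ((biInter_finset_mem S).2 fun r _ => (hcont r).continuousAt.eventually_le_const
          (by simpa [ballSub_apply] using hε))
      refine ⟨g, fun r hr => ?_⟩
      have : ‖ballSub g.1 f (χ r)‖ ≤ ε / 2 := by simpa using Set.mem_iInter₂.1 hg r hr
      linarith)
  refine ⟨fun n => (d n).1, fun n => (d n).2.1, ?_⟩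
  refine tendsto_weakStarDualBall_of_separating (L := map (fun n => (d n).1) atTop) hsep' ?_
  rintro _ (⟨n, rfl⟩ | ⟨r, rfl⟩)
  · refine tendsto_map'_iff.2 (tendsto_const_nhds.congr fun k => ?_)
    exact ((d k).2.2 n).symm
  · refine tendsto_map'_iff.2 ?_
    simpa [ballSub_apply, Function.comp_def] using (hd r).add_const (f.1 (χ r))

end DualBall

/-! ### Sequential order two -/

theorem hasSequentialOrder_two_of_subset {T : Type*} [TopologicalSpace T]
    (h : ∀ F : Set T, closure F ⊆ seqClosure (seqClosure F)) {F : Set T}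
    (hF : ¬ closure F ⊆ seqClosure F) : HasSequentialOrder T 2 := by
  have h1 : ∀ G : Set T, iterSeqClosure G 1 = seqClosure G := fun G => by
    rw [← zero_add (1 : Ordinal), ← Order.succ_eq_add_one, iterSeqClosure_succ, iterSeqClosure_zero]
  refine ⟨fun G => ?_, fun β hβ => ⟨F, fun hEq => hF ?_⟩⟩
  · rw [← one_add_one_eq_two, ← Order.succ_eq_add_one, iterSeqClosure_succ, h1]
    refine Set.Subset.antisymm ?_ (h G)
    exact seqClosure_subset_closure.trans
      (closure_minimal seqClosure_subset_closure isClosed_closure)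
  · rw [← one_add_one_eq_two, ← Order.succ_eq_add_one, Order.lt_succ_iff,
      Order.le_one_iff] at hβ
    rcases hβ with rfl | rfl
    · rw [iterSeqClosure_zero] at hEq
      rw [← hEq]
      exact subset_seqClosure
    · rw [h1] at hEq
      exact hEq.ge

theorem sequentialSpace_of_closure_subset {T : Type*} [TopologicalSpace T]
    (h : ∀ F : Set T, closure F ⊆ seqClosure (seqClosure F)) : SequentialSpace T := by
  refine ⟨fun F hF => isClosed_of_closure_subset ?_⟩
  have := h F
  rwa [hF.seqClosure_eq, hF.seqClosure_eq] at this

namespace JohnsonLindenstrauss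

/-! ### Functionals on `c₀` -/

section

variable (𝕜 : Type*) [RCLike 𝕜]

/-- The unit vector `e_n` of `c₀`. -/
noncomputable def cZeroUnit (n : ℕ) : cZero 𝕜 :=
  ⟨charFun 𝕜 {n}, tendsto_const_nhds.congr' <| by
    filter_upwards [eventually_gt_atTop n] with m hm
    simp [charFun_apply, hm.ne']⟩

/-- The truncation `(y_0, …, y_{N-1}, 0, 0, …)`, written as a combination of unit vectors. -/
noncomputable def truncate (N : ℕ) (y : EllInfty 𝕜) : cZero 𝕜 :=
  ∑ n ∈ Finset.range N, y n • cZeroUnit 𝕜 n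

theorem truncate_apply (N : ℕ) (y : EllInfty 𝕜) (m : ℕ) :
    (truncate 𝕜 N y : EllInfty 𝕜) m = if m < N then y m else 0 := by
  rw [truncate, Submodule.coe_sum, lp.coeFn_sum, Finset.sum_apply]
  simp [cZeroUnit, charFun_apply, Set.indicator_apply]

theorem tendsto_truncate (x : cZero 𝕜) :
    Tendsto (fun N => truncate 𝕜 N (x : EllInfty 𝕜)) atTop (𝓝 x) := by
  rw [Metric.tendsto_atTop]
  intro ε hε
  have hx : Tendsto (fun n => (x : EllInfty 𝕜) n) atTop (𝓝 0) := x.2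
  obtain ⟨N, hN⟩ := eventually_atTop.1 (hx.norm.eventually_le_const
    (show ‖(0 : 𝕜)‖ < ε / 2 by simpa using hε))
  refine ⟨N, fun k hk => lt_of_le_of_lt ?_ (half_lt_self hε)⟩
  rw [dist_eq_norm, Submodule.coe_norm]
  refine lp.norm_le_of_forall_le (half_pos hε).le fun m => ?_
  rw [Submodule.coe_sub, lp.coeFn_sub, Pi.sub_apply, truncate_apply]
  split_ifs with hm
  · simpa using (half_pos hε).le
  · simpa using hN m (hk.trans (not_lt.1 hm))

variable {𝕜}

theorem apply_truncate_eq_zero {q : cZero 𝕜 →ₗ[𝕜] 𝕜} (hq : ∀ n, q (cZeroUnit 𝕜 n) = 0) (N : ℕ)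
    (y : EllInfty 𝕜) : q (truncate 𝕜 N y) = 0 := by
  simp [truncate, hq]

theorem eq_zero_of_apply_cZeroUnit {q : cZero 𝕜 →L[𝕜] 𝕜} (hq : ∀ n, q (cZeroUnit 𝕜 n) = 0) :
    q = 0 := by
  ext x
  refine tendsto_nhds_unique ((q.continuous.tendsto x).comp (tendsto_truncate 𝕜 x)) ?_
  exact tendsto_const_nhds.congr fun N => (apply_truncate_eq_zero (q := q.toLinearMap) hq N _).symm

end

/-! ### The dual of the Johnson–Lindenstrauss space -/

section

variable (𝕜 : Type*) [RCLike 𝕜] {𝒜 : Set (Set ℕ)} (h : IsAlmostDisjointFamily 𝒜)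

theorem toEllInfty_mkSpan (x : cZero 𝕜) (a : 𝒜 →₀ 𝕜) :
    toEllInfty 𝕜 h (mkSpan 𝕜 h x a) = x + a.sum fun A c => c • charFun 𝕜 (A : Set ℕ) := rfl

theorem toEllInfty_injective : Function.Injective (toEllInfty 𝕜 h) := Subtype.coe_injective

/-- The isometric inclusion of `c₀` into `JL₂`. -/
noncomputable def ofCZero : cZero 𝕜 →L[𝕜] JLTwo 𝕜 h :=
  UniformSpace.Completion.toComplL ∘L LinearMap.mkContinuous
    { toFun := fun x => mkSpan 𝕜 h x 0
      map_add' := fun x y => toEllInfty_injective 𝕜 h <| by simp [toEllInfty_mkSpan]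
      map_smul' := fun c x => toEllInfty_injective 𝕜 h <| by simp [toEllInfty_mkSpan] }
    1 fun x => by simp [norm_mkSpan]

/-- The vector `χ_A` of `JL₂`, for `A` in the family. -/
noncomputable def charVec (A : 𝒜) : JLTwo 𝕜 h :=
  (mkSpan 𝕜 h 0 (Finsupp.single A 1) : JLSpan 𝕜 h)

theorem coe_mkSpan (x : cZero 𝕜) (a : 𝒜 →₀ 𝕜) :
    ((mkSpan 𝕜 h x a : JLSpan 𝕜 h) : JLTwo 𝕜 h) =
      ofCZero 𝕜 h x + ∑ A ∈ a.support, a A • charVec 𝕜 h A := by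
  have hspan : mkSpan 𝕜 h x a =
      mkSpan 𝕜 h x 0 + ∑ A ∈ a.support, a A • mkSpan 𝕜 h 0 (Finsupp.single A 1) :=
    toEllInfty_injective 𝕜 h <| by simp [toEllInfty_mkSpan, Finsupp.sum]
  rw [hspan]
  change UniformSpace.Completion.toComplL (𝕜 := 𝕜) _ = _
  rw [map_add, map_sum]
  simp only [map_smul]
  rfl

variable {𝕜 h}

theorem apply_ofCZero_eq_zero {f : StrongDual 𝕜 (JLTwo 𝕜 h)}
    (hf : ∀ n, f (ofCZero 𝕜 h (cZeroUnit 𝕜 n)) = 0) (x : cZero 𝕜) : f (ofCZero 𝕜 h x) = 0 :=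
  DFunLike.congr_fun (eq_zero_of_apply_cZeroUnit (q := f ∘L ofCZero 𝕜 h) hf) x

theorem eq_zero_of_apply_charVec {f : StrongDual 𝕜 (JLTwo 𝕜 h)}
    (hf : ∀ n, f (ofCZero 𝕜 h (cZeroUnit 𝕜 n)) = 0) (hf' : ∀ A, f (charVec 𝕜 h A) = 0) :
    f = 0 := by
  ext y
  induction y using UniformSpace.Completion.induction_on with
  | hp => exact isClosed_eq f.continuous continuous_const
  | ih y =>
    obtain ⟨x, a, rfl⟩ := mkSpan_surjective 𝕜 h y
    simp [coe_mkSpan, apply_ofCZero_eq_zero hf, hf']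

theorem exists_forall_eq_of_mem_of_mem (h : IsAlmostDisjointFamily 𝒜) (S : Finset 𝒜) :
    ∃ N, ∀ A ∈ S, ∀ B ∈ S, ∀ m, N ≤ m → m ∈ (A : Set ℕ) → m ∈ (B : Set ℕ) → A = B := by
  have hfin : (⋃ p ∈ S.offDiag, ((p.1 : Set ℕ) ∩ (p.2 : Set ℕ))).Finite :=
    Set.Finite.biUnion S.offDiag.finite_toSet fun p hp =>
      h.2 p.1.2 p.2.2 fun hAB => (Finset.mem_offDiag.1 hp).2.2 (Subtype.ext hAB)
  obtain ⟨N, hN⟩ := hfin.bddAbove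
  refine ⟨N + 1, fun A hA B hB m hm hmA hmB => ?_⟩
  by_contra hAB
  have : m ≤ N := hN (Set.mem_iUnion₂.2 ⟨(A, B), Finset.mem_offDiag.2 ⟨hA, hB, hAB⟩, hmA, hmB⟩)
  omega

/-- Modulo `c₀`, the finite sum `∑ a_A χ_A` has norm at most `(∑ |a_A|²)^{1/2}`: the sets `A` become
disjoint when an initial segment of `ℕ` is removed. -/
theorem exists_norm_mkSpan_le (S : Finset 𝒜) (a : 𝒜 →₀ 𝕜) (ha : a.support ⊆ S) :
    ∃ x : cZero 𝕜, ‖mkSpan 𝕜 h x a‖ ≤ √(∑ A ∈ S, ‖a A‖ ^ 2) := by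
  obtain ⟨N, hN⟩ := exists_forall_eq_of_mem_of_mem h S
  set y : EllInfty 𝕜 := a.sum fun A c => c • charFun 𝕜 (A : Set ℕ) with hy
  have hsum : ∑ A ∈ a.support, ‖a A‖ ^ 2 = ∑ A ∈ S, ‖a A‖ ^ 2 :=
    Finset.sum_subset ha fun A _ hA => by simp [Finsupp.notMem_support_iff.1 hA]
  refine ⟨-truncate 𝕜 N y, ?_⟩
  rw [norm_mkSpan, hsum]
  refine max_le (lp.norm_le_of_forall_le (Real.sqrt_nonneg _) fun m => ?_) le_rfl
  rw [← hy, Submodule.coe_neg, lp.coeFn_add, lp.coeFn_neg, Pi.add_apply, Pi.neg_apply,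
    truncate_apply]
  split_ifs with hm
  · simp
  rw [neg_zero, zero_add]
  have hym : y m = ∑ A ∈ S, a A * (A : Set ℕ).indicator (fun _ => (1 : 𝕜)) m := by
    rw [hy, Finsupp.sum_of_support_subset _ ha _ (by simp), lp.coeFn_sum, Finset.sum_apply]
    rfl
  by_cases hA : ∃ A ∈ S, m ∈ (A : Set ℕ)
  · obtain ⟨A, hAS, hmA⟩ := hA
    rw [hym, Finset.sum_eq_single_of_mem A hAS]
    · refine Real.le_sqrt_of_sq_le ?_
      simpa [hmA] using Finset.single_le_sum (f := fun A => ‖a A‖ ^ 2)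
        (fun _ _ => sq_nonneg _) hAS
    · intro B hB hBA
      have hmB : m ∉ (B : Set ℕ) := fun hmB => hBA (hN B hB A hAS m (not_lt.1 hm) hmB hmA)
      simp [hmB]
  · push Not at hA
    rw [hym, Finset.sum_eq_zero fun A hAS => by simp [hA A hAS], norm_zero]
    exact Real.sqrt_nonneg _

/-- On the annihilator of `c₀`, which is the dual of `JL₂ / c₀ = ℓ₂(𝒜)`, the map `f ↦ (f (χ_A))` is a
contraction into `ℓ₂(𝒜)`. -/
theorem sum_norm_apply_charVec_sq_le {f : StrongDual 𝕜 (JLTwo 𝕜 h)}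
    (hf : ∀ n, f (ofCZero 𝕜 h (cZeroUnit 𝕜 n)) = 0) (S : Finset 𝒜) :
    ∑ A ∈ S, ‖f (charVec 𝕜 h A)‖ ^ 2 ≤ ‖f‖ ^ 2 := by
  classical
  set s := ∑ A ∈ S, ‖f (charVec 𝕜 h A)‖ ^ 2 with hs
  have hs0 : 0 ≤ s := Finset.sum_nonneg fun _ _ => sq_nonneg _
  -- Test `f` on the vector with coefficients `conj (f χ_A)`.
  let a : 𝒜 →₀ 𝕜 := Finsupp.indicator S fun A _ => starRingEnd 𝕜 (f (charVec 𝕜 h A))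
  have ha : ∀ A ∈ S, a A = starRingEnd 𝕜 (f (charVec 𝕜 h A)) := fun A hA =>
    Finsupp.indicator_of_mem hA _
  have hasupp : a.support ⊆ S := Finsupp.support_indicator_subset _ _
  obtain ⟨x, hx⟩ := exists_norm_mkSpan_le (h := h) S a hasupp
  have hsum : ∑ A ∈ S, ‖a A‖ ^ 2 = s := Finset.sum_congr rfl fun A hA => by rw [ha A hA]; simp
  have hfs : f (mkSpan 𝕜 h x a : JLSpan 𝕜 h) = (s : 𝕜) := by
    rw [coe_mkSpan, map_add, apply_ofCZero_eq_zero hf, zero_add, map_sum,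
      Finset.sum_subset hasupp fun A _ hA => by simp [Finsupp.notMem_support_iff.1 hA], hs]
    push_cast
    refine Finset.sum_congr rfl fun A hA => ?_
    rw [map_smul, ha A hA, smul_eq_mul, RCLike.conj_mul]
  have hle : √s * √s ≤ ‖f‖ * √s := by
    calc √s * √s = ‖f (mkSpan 𝕜 h x a : JLSpan 𝕜 h)‖ := by
          rw [hfs, Real.mul_self_sqrt hs0, RCLike.norm_of_nonneg hs0]
      _ ≤ ‖f‖ * ‖((mkSpan 𝕜 h x a : JLSpan 𝕜 h) : JLTwo 𝕜 h)‖ := f.le_opNorm _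
      _ ≤ ‖f‖ * √s := by
          rw [UniformSpace.Completion.norm_coe, ← hsum]
          exact mul_le_mul_of_nonneg_left hx (norm_nonneg _)
  rw [← Real.sqrt_le_left (norm_nonneg f)]
  rcases (Real.sqrt_nonneg s).eq_or_lt with h0 | h0
  · rw [← h0]
    exact norm_nonneg f
  · exact le_of_mul_le_mul_right hle h0

/-! ### Coordinate functionals -/

variable (𝕜 h)

/-- The coordinate functional `y ↦ y_n`, as an element of the dual ball. -/
noncomputable def coordBall (n : ℕ) : weakStarDualBall 𝕜 (JLTwo 𝕜 h) :=
  ⟨StrongDual.toWeakDual ((LinearMap.mkContinuous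
    { toFun := fun y => toEllInfty 𝕜 h y n
      map_add' := fun _ _ => by simp
      map_smul' := fun _ _ => by simp } 1 fun y => by
        rw [one_mul]
        exact (lp.norm_apply_le_norm ENNReal.top_ne_zero (toEllInfty 𝕜 h y) n).trans
          (le_max_left _ _)).extend UniformSpace.Completion.toComplL), by
    refine (ContinuousLinearMap.opNorm_extend_le (N := 1) _
      UniformSpace.Completion.denseRange_coe fun y => ?_).trans ?_
    · simp
    · rw [NNReal.coe_one, one_mul]
      exact LinearMap.mkContinuous_norm_le _ zero_le_one _⟩

theorem coordBall_apply_coe (n : ℕ) (y : JLSpan 𝕜 h) :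
    (coordBall 𝕜 h n).1 (y : JLTwo 𝕜 h) = toEllInfty 𝕜 h y n :=
  ContinuousLinearMap.extend_eq _ UniformSpace.Completion.denseRange_coe
    (UniformSpace.Completion.isUniformInducing_coe _) y

theorem coordBall_apply_cZeroUnit (n m : ℕ) :
    (coordBall 𝕜 h n).1 (ofCZero 𝕜 h (cZeroUnit 𝕜 m)) = if n = m then 1 else 0 := by
  refine (coordBall_apply_coe 𝕜 h n (mkSpan 𝕜 h (cZeroUnit 𝕜 m) 0)).trans ?_
  simp [toEllInfty_mkSpan, cZeroUnit, charFun_apply, Set.indicator_apply]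

theorem coordBall_apply_charVec (n : ℕ) (A : 𝒜) :
    (coordBall 𝕜 h n).1 (charVec 𝕜 h A) = (A : Set ℕ).indicator (fun _ => (1 : 𝕜)) n := by
  refine (coordBall_apply_coe 𝕜 h n (mkSpan 𝕜 h 0 (Finsupp.single A 1))).trans ?_
  simp [toEllInfty_mkSpan, charFun_apply]

/-- The zero functional, as an element of the dual ball. -/
noncomputable def zeroBall : weakStarDualBall 𝕜 (JLTwo 𝕜 h) := ⟨0, by simp [weakStarDualBall]⟩

/-- As infinitely many members of the family exist, finitely many of them do not cover a cofinite
set; so `0` is a weak* cluster point of the coordinate functionals. -/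
theorem zeroBall_mem_closure (hinf : 𝒜.Infinite) :
    zeroBall 𝕜 h ∈ closure (Set.range (coordBall 𝕜 h)) := by
  classical
  let G : Filter ℕ := ⨅ S : Finset 𝒜, cofinite ⊓ 𝓟 (⋃ A ∈ S, (A : Set ℕ))ᶜ
  have hG : G.NeBot := by
    refine iInf_neBot_of_directed' (directed_of_isDirected_le fun S S' hS => inf_le_inf_left _
      (principal_mono.2 (Set.compl_subset_compl.2 (Set.biUnion_subset_biUnion_left hS)))) ?_
    intro S
    obtain ⟨B, hB, hBS⟩ := hinf.exists_notMem_finset (S.image Subtype.val)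
    refine frequently_mem_iff_neBot.1 (frequently_cofinite_iff_infinite.2 ?_)
    have hfin : (⋃ A ∈ S, B ∩ (A : Set ℕ)).Finite :=
      Set.Finite.biUnion S.finite_toSet fun A hA => h.2 hB A.2 fun hBA =>
        hBS (Finset.mem_image.2 ⟨A, hA, hBA.symm⟩)
    refine ((h.1 B hB).sdiff hfin).mono fun n hn hnS => hn.2 ?_
    obtain ⟨A, hA, hnA⟩ := Set.mem_iUnion₂.1 hnS
    exact Set.mem_biUnion hA ⟨hn.1, hnA⟩
  refine mem_closure_of_tendsto (f := coordBall 𝕜 h) (b := G) ?_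
    (Eventually.of_forall fun n => ⟨n, rfl⟩)
  refine tendsto_weakStarDualBall_of_separating
    (Z := Set.range (fun n => ofCZero 𝕜 h (cZeroUnit 𝕜 n)) ∪ Set.range (charVec 𝕜 h))
    (fun f hf => eq_zero_of_apply_charVec (fun n => hf _ (Or.inl ⟨n, rfl⟩))
      fun A => hf _ (Or.inr ⟨A, rfl⟩)) ?_
  rintro _ (⟨m, rfl⟩ | ⟨A, rfl⟩)
  · refine tendsto_map'_iff.2 (tendsto_const_nhds.congr' ?_)
    have hm : ∀ᶠ n in G, n ≠ m :=
      (iInf_le _ ∅ : G ≤ _).trans inf_le_left (Set.finite_singleton m).compl_mem_cofinite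
    filter_upwards [hm] with n hn
    simp only [Function.comp_apply, coordBall_apply_cZeroUnit, if_neg hn]
    rfl
  · refine tendsto_map'_iff.2 (tendsto_const_nhds.congr' ?_)
    have hA : ∀ᶠ n in G, n ∉ (A : Set ℕ) := by
      refine (iInf_le _ {A} : G ≤ _).trans inf_le_right ?_
      simp [Set.subset_def]
    filter_upwards [hA] with n hn
    simp only [Function.comp_apply, coordBall_apply_charVec, Set.indicator_of_notMem hn]
    rfl

end

end JohnsonLindenstrauss

/-! ### Maximal almost disjoint families -/

theorem Maximal.exists_mem_infinite_inter {𝒜 : Set (Set ℕ)} (h : Maximal IsAlmostDisjointFamily 𝒜)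
    {R : Set ℕ} (hR : R.Infinite) : ∃ A ∈ 𝒜, (R ∩ A).Infinite := by
  by_contra! hcon
  have hAD : IsAlmostDisjointFamily (insert R 𝒜) := by
    refine ⟨?_, ?_⟩
    · rintro A (rfl | hA)
      exacts [hR, h.prop.1 A hA]
    · refine h.prop.2.insert fun A hA _ => ⟨hcon A hA, ?_⟩
      rw [Set.inter_comm]
      exact hcon A hA
  have hmem : R ∈ 𝒜 := h.le_of_ge hAD (Set.subset_insert R 𝒜) (Set.mem_insert R 𝒜)
  exact hR (Set.inter_self R ▸ hcon R hmem)

/-- The branches of the binary tree `List Bool`, transported to `ℕ`, form an uncountable almost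
disjoint family, which extends to a maximal one by Zorn's lemma. -/
theorem exists_maximal_isAlmostDisjointFamily_not_countable :
    ∃ 𝒜 : Set (Set ℕ), Maximal IsAlmostDisjointFamily 𝒜 ∧ ¬ 𝒜.Countable := by
  let node : (ℕ → Bool) → ℕ → ℕ := fun x n => Encodable.encode ((List.range n).map x)
  have hnode : ∀ x y m n, node x m = node y n → m = n ∧ ∀ i < m, x i = y i := by
    intro x y m n hxy
    have hlist := Encodable.encode_injective hxy
    have hmn : m = n := by simpa using congrArg List.length hlist
    subst hmn
    exact ⟨rfl, fun i hi => List.map_inj_left.1 hlist i (List.mem_range.2 hi)⟩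
  have hbranch : ∀ x y, x ≠ y → (Set.range (node x) ∩ Set.range (node y)).Finite := by
    intro x y hxy
    obtain ⟨i, hi⟩ := Function.ne_iff.1 hxy
    refine ((Set.finite_Iic i).image (node x)).subset ?_
    rintro _ ⟨⟨m, rfl⟩, ⟨n, hn⟩⟩
    refine ⟨m, ?_, rfl⟩
    by_contra hm
    exact hi ((hnode x y m n hn.symm).2 i (not_le.1 hm))
  have hinf : ∀ x, (Set.range (node x)).Infinite := fun x =>
    Set.infinite_range_of_injective fun m n hmn => (hnode x x m n hmn).1
  have hAD : IsAlmostDisjointFamily (Set.range fun x => Set.range (node x)) := by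
    refine ⟨by rintro _ ⟨x, rfl⟩; exact hinf x, ?_⟩
    rintro _ ⟨x, rfl⟩ _ ⟨y, rfl⟩ hxy
    exact hbranch x y fun h => hxy (by rw [h])
  have hinj : Function.Injective fun x => Set.range (node x) := by
    intro x y hxy
    by_contra hne
    have hfin := hbranch x y hne
    have hxy' : Set.range (node x) = Set.range (node y) := hxy
    rw [← hxy', Set.inter_self] at hfin
    exact hinf x hfin
  obtain ⟨𝒜, hle, hmax⟩ := zorn_subset_nonempty {𝒜 | IsAlmostDisjointFamily 𝒜} (by
    intro c hc hchain _
    refine ⟨⋃₀ c, ⟨?_, ?_⟩, fun s hs => Set.subset_sUnion_of_mem hs⟩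
    · rintro A ⟨s, hs, hA⟩
      exact (hc hs).1 A hA
    · exact (Set.pairwise_sUnion hchain.directedOn).2 fun s hs => (hc hs).2) _ hAD
  refine ⟨𝒜, hmax, fun hcount => ?_⟩
  have h1 := hcount.mono hle
  have h2 : Countable (Set.range fun x => Set.range (node x)) := h1.to_subtype
  have : Countable (ℕ → Bool) := (Set.rangeFactorization_injective.2 hinj).countable
  obtain ⟨g, hg⟩ := exists_surjective_nat (ℕ → Bool)
  obtain ⟨n, hn⟩ := hg fun n => !g n n
  simpa using congrFun hn n

namespace JohnsonLindenstrauss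

/-- If the coordinate functionals at `u 0, u 1, …` tend to `0`, then `u` tends to infinity and
leaves each member of the family, so the range of `u` contradicts maximality. -/
theorem zeroBall_notMem_seqClosure (𝕜 : Type*) [RCLike 𝕜] {𝒜 : Set (Set ℕ)}
    (h : Maximal IsAlmostDisjointFamily 𝒜) :
    zeroBall 𝕜 h.prop ∉ seqClosure (Set.range (coordBall 𝕜 h.prop)) := by
  rintro ⟨v, hv, hlim⟩
  choose u hu using hv
  have heval : ∀ x, Tendsto (fun k => (coordBall 𝕜 h.prop (u k)).1 x) atTop (𝓝 0) := by
    intro x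
    obtain rfl : v = fun k => coordBall 𝕜 h.prop (u k) := funext fun k => (hu k).symm
    exact ((continuous_weakStarDualBall_eval x).tendsto _).comp hlim
  have hsmall : ∀ x, ∀ᶠ k in atTop, (coordBall 𝕜 h.prop (u k)).1 x ≠ 1 := fun x =>
    (heval x).eventually (isOpen_ne.mem_nhds zero_ne_one)
  have hrange : (Set.range u).Infinite := by
    intro hfin
    have hev : ∀ᶠ k in atTop, ∀ m ∈ Set.range u, u k ≠ m := by
      rw [eventually_all_finite hfin]
      intro m _
      filter_upwards [hsmall (ofCZero 𝕜 h.prop (cZeroUnit 𝕜 m))] with k hk hkm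
      exact hk (by rw [coordBall_apply_cZeroUnit, if_pos hkm])
    obtain ⟨k, hk⟩ := hev.exists
    exact hk (u k) ⟨k, rfl⟩ rfl
  obtain ⟨A, hA, hinf⟩ := h.exists_mem_infinite_inter hrange
  obtain ⟨K, hK⟩ := eventually_atTop.1 (hsmall (charVec 𝕜 h.prop ⟨A, hA⟩))
  refine hinf (((Set.finite_Iio K).image u).subset ?_)
  rintro _ ⟨⟨k, rfl⟩, hkA⟩
  refine ⟨k, not_le.1 fun hk => hK k hk ?_, rfl⟩
  rw [coordBall_apply_charVec, Set.indicator_of_mem hkA]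

end JohnsonLindenstrauss

/-! ### The weak* dual ball of the Johnson–Lindenstrauss space -/

theorem mainTheorem2 (𝕜 : Type) [RCLike 𝕜] :
    (∀ (𝒜 : Set (Set ℕ)) (h𝒜 : Maximal IsAlmostDisjointFamily 𝒜), ¬ 𝒜.Countable →
      HasWeakStarSequentialDualBall 𝕜 (JohnsonLindenstrauss.JLTwo 𝕜 h𝒜.prop) ∧
      HasSequentialOrder (weakStarDualBall 𝕜 (JohnsonLindenstrauss.JLTwo 𝕜 h𝒜.prop)) 2 ∧
      ¬ HasWeakStarAngelicDual 𝕜 (JohnsonLindenstrauss.JLTwo 𝕜 h𝒜.prop)) ∧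
    ¬ ∀ (X : Type) [NormedAddCommGroup X] [NormedSpace 𝕜 X] [CompleteSpace X],
      HasWeakStarSequentialDualBall 𝕜 X → HasWeakStarAngelicDual 𝕜 X := by
  have main : ∀ (𝒜 : Set (Set ℕ)) (h𝒜 : Maximal IsAlmostDisjointFamily 𝒜), ¬ 𝒜.Countable →
      HasWeakStarSequentialDualBall 𝕜 (JohnsonLindenstrauss.JLTwo 𝕜 h𝒜.prop) ∧
      HasSequentialOrder (weakStarDualBall 𝕜 (JohnsonLindenstrauss.JLTwo 𝕜 h𝒜.prop)) 2 ∧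
      ¬ HasWeakStarAngelicDual 𝕜 (JohnsonLindenstrauss.JLTwo 𝕜 h𝒜.prop) := by
    intro 𝒜 h𝒜 hcount
    have hcl := closure_subset_seqClosure_seqClosure
      (fun n => JohnsonLindenstrauss.ofCZero 𝕜 h𝒜.prop (JohnsonLindenstrauss.cZeroUnit 𝕜 n))
      (JohnsonLindenstrauss.charVec 𝕜 h𝒜.prop)
      (fun _ => JohnsonLindenstrauss.eq_zero_of_apply_charVec)
      (fun _ => JohnsonLindenstrauss.sum_norm_apply_charVec_sq_le)
    have h0 : ¬ closure (Set.range (JohnsonLindenstrauss.coordBall 𝕜 h𝒜.prop)) ⊆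
        seqClosure (Set.range (JohnsonLindenstrauss.coordBall 𝕜 h𝒜.prop)) := fun hsub =>
      JohnsonLindenstrauss.zeroBall_notMem_seqClosure 𝕜 h𝒜
        (hsub (JohnsonLindenstrauss.zeroBall_mem_closure 𝕜 h𝒜.prop
          fun hfin => hcount hfin.countable))
    exact ⟨sequentialSpace_of_closure_subset hcl, hasSequentialOrder_two_of_subset hcl h0,
      fun hFU => h0 (hFU.closure_subset_seqClosure _)⟩
  refine ⟨main, fun hall => ?_⟩
  obtain ⟨𝒜, h𝒜, hcount⟩ := exists_maximal_isAlmostDisjointFamily_not_countable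
  obtain ⟨hseq, -, hnot⟩ := main 𝒜 h𝒜 hcount
  exact hnot (hall _ hseq)
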